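/- Let $k$ be a field of characteristic $0$ and let $q$ be a natural number. For a partition $\beta$ of $q$ let $\chi_\beta$ be the irreducible character of the symmetric group $\mathcal S_q$ attached to $\beta$ in the usual way (the character of the Specht module $k[\mathcal S_q]c_\beta$, where $c_\beta$ is the Young symmetrizer; so $\chi_{(q)}$ is the trivial character and $\chi_{(1^q)}$ is the sign character). For a $q\times q$ matrix $A=(A_{i,j})$ over $k$ put $$\mathrm{im}_\beta(A)=\sum_{\pi\in\mathcal S_q}\chi_\beta(\pi)\prod_{i=1}^q A_{i,\pi(i)} .$$ Let $D_q=\mathrm{diag}(1,\tfrac12,\dots,\tfrac1q)$, let $R_q$ be the $q\times q$ matrix with all entries equal to $1$, and let $T_q$ be the $q\times q$ matrix whose $(i,j)$ entry ($1\le i,j\le q$) is $(-1)^{i-j}$ if $j\le i$, is $i$ if $j=i+1$, and is $0$ if $j>i+1$. Put $H_q=D_qR_q$ and $E_q=D_qT_q$. Then: (i) $\mathrm{per}(H_q)=1$, and $\mathrm{im}_\beta(H_q)=0$ for every partition $\beta$ of $q$ with $\beta\neq(q)$; (ii) $\det(E_q)=1$, and $\mathrm{im}_\beta(E_q)=0$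 for every partition $\beta$ of $q$ with $\beta\neq(1^q)$. -/

import Mathlib

/-- The row (counted from `0`) of the `i`-th box, `i = 0, 1, 2, …`, when the boxes of the diagram
with row lengths `l` are read row by row from top to bottom, and from left to right in each row. -/
def rowOf : List ℕ → ℕ → ℕ
  | [], _ => 0
  | a :: l, i => if i < a then 0 else rowOf l (i - a) + 1

/-- The column (counted from `0`) of the `i`-th box in the same reading order. -/
def colOf : List ℕ → ℕ → ℕ
  | [], i => i
  | a :: l, i => if i < a then i else colOf l (i - a)

namespace Nat.Partition

/-- The row lengths `λ₁ ≥ λ₂ ≥ ⋯ > 0` of the Young diagram of a partition. -/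
def rowLengths {q : ℕ} (β : Nat.Partition q) : List ℕ :=
  β.parts.sort (fun a b => a ≥ b)

/-- The partition `(1^q)`. (The partition `(q)` is `Nat.Partition.indiscrete q`.) -/
def column (q : ℕ) : Nat.Partition q where
  parts := Multiset.replicate q 1
  parts_pos := fun h => by rw [Multiset.eq_of_mem_replicate h]; exact Nat.one_pos
  parts_sum := by simp

/-- The permutations that preserve each row of the standard tableau of shape `β` in which
`0, 1, …, q - 1` are entered row by row. -/
def rowStabilizer {q : ℕ} (β : Nat.Partition q) : Finset (Equiv.Perm (Fin q)) :=
  Finset.univ.filter fun π => ∀ i : Fin q, rowOf β.rowLengths (π i) = rowOf β.rowLengths i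

/-- The permutations that preserve each column of that tableau. -/
def columnStabilizer {q : ℕ} (β : Nat.Partition q) : Finset (Equiv.Perm (Fin q)) :=
  Finset.univ.filter fun π => ∀ i : Fin q, colOf β.rowLengths (π i) = colOf β.rowLengths i

end Nat.Partition

noncomputable section

/-- The Young symmetrizer `c_β = (∑ ρ) * (∑ sgn(κ) κ)` in the group algebra of the symmetric group,
with `ρ` running over the row stabilizer and `κ` over the column stabilizer. -/
def youngSymmetrizer (k : Type*) [Field k] {q : ℕ} (β : Nat.Partition q) :
    MonoidAlgebra k (Equiv.Perm (Fin q)) :=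
  (∑ ρ ∈ β.rowStabilizer, MonoidAlgebra.single ρ (1 : k)) *
    (∑ κ ∈ β.columnStabilizer, MonoidAlgebra.single κ (((Equiv.Perm.sign κ : ℤˣ) : ℤ) : k))

/-- The Specht module `k[S_q] c_β`, as a left ideal of the group algebra. In characteristic zero
these are the irreducible modules of the symmetric group, one for each partition of `q`. -/
def spechtModule (k : Type*) [Field k] {q : ℕ} (β : Nat.Partition q) :
    Ideal (MonoidAlgebra k (Equiv.Perm (Fin q))) :=
  Ideal.span {youngSymmetrizer k β}

/-- The representation of the symmetric group on the Specht module by left multiplication. -/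
def spechtRep (k : Type*) [Field k] {q : ℕ} (β : Nat.Partition q) :
    Representation k (Equiv.Perm (Fin q)) (spechtModule k β) :=
  ((Algebra.lsmul k k (spechtModule k β)).toMonoidHom).comp
    (MonoidAlgebra.of k (Equiv.Perm (Fin q)))

/-- The irreducible character `χ_β` of the symmetric group. -/
def irrChar (k : Type*) [Field k] {q : ℕ} (β : Nat.Partition q) (π : Equiv.Perm (Fin q)) : k :=
  (spechtRep k β).character π

/-- The immanant `im_β(A) = ∑_π χ_β(π) ∏_i A_{i,π(i)}`. -/
def immanant {k : Type*} [Field k] {q : ℕ} (β : Nat.Partition q)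
    (A : Matrix (Fin q) (Fin q) k) : k :=
  ∑ π : Equiv.Perm (Fin q), irrChar k β π * ∏ i : Fin q, A i (π i)

/-- The diagonal matrix `D_q` with entries `1, 1/2, …, 1/q`. -/
def matD (k : Type*) [Field k] (q : ℕ) : Matrix (Fin q) (Fin q) k :=
  Matrix.diagonal fun i => 1 / (((i : ℕ) : k) + 1)

/-- The matrix `H_q`: the product of `D_q` and the all-ones matrix. -/
def matH (k : Type*) [Field k] (q : ℕ) : Matrix (Fin q) (Fin q) k :=
  matD k q * Matrix.of fun _ _ => 1

/-- The matrix `T_q`. With rows and columns counted from `1`, its `(i,j)` entry is `(-1)^(i-j)` if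
`j ≤ i`, it is `i` if `j = i + 1`, and it is `0` if `j > i + 1`. In the code indices start at `0`,
so the entry to the right of the diagonal in row `i` is `i + 1`. -/
def matT (k : Type*) [Field k] (q : ℕ) : Matrix (Fin q) (Fin q) k :=
  Matrix.of fun i j =>
    if (j : ℕ) ≤ i then (-1) ^ ((i : ℕ) - j)
    else if (j : ℕ) = i + 1 then ((i : ℕ) : k) + 1
    else 0

/-- The matrix `E_q = D_q T_q`. -/
def matE (k : Type*) [Field k] (q : ℕ) : Matrix (Fin q) (Fin q) k :=
  matD k q * matT k q

end

/-! Factoring out `matD` contributes $1/q!$ to every product. For $H_q$ this leaves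
$\frac1{q!}\sum_\pi\chi_\beta(\pi)$, which vanishes because the trivial character does not occur in
the Specht module of $\beta\ne(q)$. For $E_q$, the nonzero products of $T_q$ are $\mathrm{sgn}(\pi)$
times nonnegative integer Hessenberg weights (`sign_mul_prod_partialHessenberg`). Against class
functions these weights act like the all-ones matrix (`sum_partialHessenberg_zero`), so what remains
is $\frac1{q!}\sum_\pi\mathrm{sgn}(\pi)\chi_\beta(\pi)$, and the sign character does not occur for
$\beta\ne(1^q)$. -/

open Equiv

/-! ### Linear characters and Specht modules -/

section SpechtModule

variable {k : Type*} [Field k]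

/-- The sum `∑ ψ(g⁻¹) g` in the group algebra spans the `ψ`-isotypic left ideal. -/
theorem twistedSum_mul {G : Type*} [Group G] [Fintype G] (ψ : G →* k) (x : MonoidAlgebra k G) :
    (∑ g : G, MonoidAlgebra.single g (ψ g⁻¹)) * x =
      MonoidAlgebra.lift k k G ψ x • ∑ g : G, MonoidAlgebra.single g (ψ g⁻¹) := by
  induction x using MonoidAlgebra.induction_linear with
  | zero => simp
  | add x y hx hy => rw [mul_add, hx, hy, map_add, add_smul]
  | single h r =>
    rw [MonoidAlgebra.lift_single, Finset.sum_mul, Finset.smul_sum]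
    refine Fintype.sum_equiv (Equiv.mulRight h) _ _ fun g => ?_
    rw [MonoidAlgebra.single_mul_single, MonoidAlgebra.smul_single, coe_mulRight, mul_inv_rev,
      map_mul, smul_eq_mul, smul_eq_mul]
    congr 1
    have : ψ h * ψ h⁻¹ = 1 := by rw [← map_mul, mul_inv_cancel, map_one]
    linear_combination (-(r * ψ g⁻¹)) * this

/-- The twisted sum multiplies $y c_\beta$ to a multiple of $\psi(y)\psi(c_\beta)=0$, so it acts on
the Specht module as zero; its trace is the sum in question. -/
theorem sum_mul_irrChar_eq_zero {q : ℕ} (β : Nat.Partition q) (ψ : Perm (Fin q) →* k)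
    (h : MonoidAlgebra.lift k k (Perm (Fin q)) ψ (youngSymmetrizer k β) = 0) :
    ∑ π, ψ π⁻¹ * irrChar k β π = 0 := by
  have hop : ∑ π, ψ π⁻¹ • spechtRep k β π = 0 := by
    refine LinearMap.ext fun ⟨x, hx⟩ => Subtype.ext ?_
    obtain ⟨y, rfl⟩ := Ideal.mem_span_singleton'.1 hx
    have key := twistedSum_mul ψ (y * youngSymmetrizer k β)
    rw [map_mul, h, mul_zero, zero_smul, Finset.sum_mul] at key
    rw [LinearMap.sum_apply, AddSubmonoidClass.coe_finsetSum, LinearMap.zero_apply,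
      ZeroMemClass.coe_zero, ← key]
    refine Finset.sum_congr rfl fun π _ => ?_
    change ψ π⁻¹ • (MonoidAlgebra.single π (1 : k) * (y * youngSymmetrizer k β)) = _
    rw [← smul_mul_assoc, MonoidAlgebra.smul_single, smul_eq_mul, mul_one]
  have := congrArg (LinearMap.trace k _) hop
  simpa [map_sum, irrChar, Representation.character] using this

theorem irrChar_conj {q : ℕ} (β : Nat.Partition q) (g h : Perm (Fin q)) :
    irrChar k β (h * g * h⁻¹) = irrChar k β g :=
  Representation.char_conj _ _ _

theorem sum_sign_eq_zero_of_swap [CharZero k] {α : Type*} [Fintype α] [DecidableEq α]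
    {s : Finset (Perm α)} {a b : α} (hab : a ≠ b) (hs : ∀ π ∈ s, swap a b * π ∈ s) :
    ∑ π ∈ s, ((Perm.sign π : ℤ) : k) = 0 := by
  refine Finset.sum_involution (fun π _ => swap a b * π) ?_ ?_ hs ?_
  · intro π _
    simp [Perm.sign_swap hab]
  · intro π _ _ h
    exact hab (swap_eq_one_iff.1 (mul_eq_right.1 h))
  · intro π _
    simp

/-- The sign character with values in `k`. -/
def permSignHom (k : Type*) [Field k] (α : Type*) [Fintype α] [DecidableEq α] : Perm α →* k :=
  ((Int.castRingHom k : ℤ →* k).comp (Units.coeHom ℤ)).comp Perm.sign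

theorem permSignHom_apply {α : Type*} [Fintype α] [DecidableEq α] (π : Perm α) :
    permSignHom k α π = ((Perm.sign π : ℤ) : k) := rfl

theorem lift_youngSymmetrizer {q : ℕ} (β : Nat.Partition q) (ψ : Perm (Fin q) →* k) :
    MonoidAlgebra.lift k k (Perm (Fin q)) ψ (youngSymmetrizer k β) =
      (∑ ρ ∈ β.rowStabilizer, ψ ρ) *
        ∑ κ ∈ β.columnStabilizer, ((Perm.sign κ : ℤ) : k) * ψ κ := by
  simp [youngSymmetrizer, map_sum, MonoidAlgebra.lift_single]

theorem rowLengths_sum {q : ℕ} (β : Nat.Partition q) : β.rowLengths.sum = q := by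
  rw [← Multiset.sum_coe, Nat.Partition.rowLengths, Multiset.sort_eq, β.parts_sum]

theorem rowLengths_pos {q : ℕ} (β : Nat.Partition q) {a : ℕ} (h : a ∈ β.rowLengths) : 0 < a :=
  β.parts_pos ((Multiset.mem_sort _).1 h)

theorem exists_colOf_eq {q : ℕ} (β : Nat.Partition q) (hβ : β ≠ Nat.Partition.indiscrete q) :
    ∃ a b : Fin q, a ≠ b ∧ colOf β.rowLengths a = colOf β.rowLengths b := by
  have hs := rowLengths_sum β
  have hp := fun a => rowLengths_pos β (a := a)
  have hc : (β.rowLengths : Multiset ℕ) = β.parts := Multiset.sort_eq _ _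
  have hq : q ≠ 0 := by
    rintro rfl
    exact hβ (Subsingleton.elim _ _)
  rcases h : β.rowLengths with _ | ⟨a, _ | ⟨b, l⟩⟩
  · simp [h] at hs
    omega
  · refine absurd ?_ hβ
    ext1
    rw [← hc, h, Nat.Partition.indiscrete_parts hq]
    simp [h] at hs
    simp [hs]
  · simp only [h, List.sum_cons] at hs
    have ha := hp a (by simp [h])
    have hb := hp b (by simp [h])
    -- The first boxes of the first two rows.
    refine ⟨⟨0, by omega⟩, ⟨a, by omega⟩, by simp [Fin.ext_iff]; omega, ?_⟩
    simp [colOf, ha, hb]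

theorem exists_rowOf_eq {q : ℕ} (β : Nat.Partition q) (hβ : β ≠ Nat.Partition.column q) :
    ∃ a b : Fin q, a ≠ b ∧ rowOf β.rowLengths a = rowOf β.rowLengths b := by
  have hs := rowLengths_sum β
  have hp := fun a => rowLengths_pos β (a := a)
  have hc : (β.rowLengths : Multiset ℕ) = β.parts := Multiset.sort_eq _ _
  have hso : β.rowLengths.Pairwise (fun a b => a ≥ b) := Multiset.pairwise_sort _ _
  have hbig : ∃ a l, β.rowLengths = a :: l ∧ 2 ≤ a := by
    by_contra! hno
    have h1 : ∀ b ∈ β.rowLengths, b = 1 := by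
      intro b hb
      have := hp b hb
      rcases h : β.rowLengths with _ | ⟨a, l⟩
      · simp [h] at hb
      · have ha := hno a l h
        rw [h] at hb hso
        rcases List.mem_cons.1 hb with rfl | hb
        · omega
        · have := (List.pairwise_cons.1 hso).1 b hb
          omega
    have h2 := List.eq_replicate_of_mem h1
    have h3 : β.rowLengths.length = q := by
      rw [h2] at hs
      simpa using hs
    refine hβ (Nat.Partition.ext ?_)
    rw [← hc, h2, h3]
    rfl
  obtain ⟨a, l, h, ha⟩ := hbig
  rw [h, List.sum_cons] at hs
  refine ⟨⟨0, by omega⟩, ⟨1, by omega⟩, by simp [Fin.ext_iff], ?_⟩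
  simp only [h, rowOf]
  rw [if_pos (by omega), if_pos (by omega)]

theorem apply_swap_eq {α γ : Type*} [DecidableEq α] {f : α → γ} {a b : α} (h : f a = f b) (x : α) :
    f (swap a b x) = f x := by
  rw [swap_apply_def]
  split_ifs with h1 h2
  · rw [h1, h]
  · rw [h2, h]
  · rfl

theorem sum_irrChar_eq_zero [CharZero k] {q : ℕ} (β : Nat.Partition q)
    (hβ : β ≠ Nat.Partition.indiscrete q) : ∑ π, irrChar k β π = 0 := by
  obtain ⟨a, b, hab, h⟩ := exists_colOf_eq β hβ
  have hcol : ∑ κ ∈ β.columnStabilizer, ((Perm.sign κ : ℤ) : k) = 0 := by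
    refine sum_sign_eq_zero_of_swap hab fun π hπ => ?_
    simp only [Nat.Partition.columnStabilizer, Finset.mem_filter, Finset.mem_univ, true_and] at hπ ⊢
    intro i
    rw [Perm.mul_apply, ← hπ i]
    exact apply_swap_eq (f := fun x : Fin q => colOf β.rowLengths x) h (π i)
  have := sum_mul_irrChar_eq_zero (k := k) β 1 (by
    rw [lift_youngSymmetrizer]
    simp [hcol])
  simpa using this

theorem sum_sign_mul_irrChar_eq_zero [CharZero k] {q : ℕ} (β : Nat.Partition q)
    (hβ : β ≠ Nat.Partition.column q) :
    ∑ π, ((Perm.sign π : ℤ) : k) * irrChar k β π = 0 := by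
  obtain ⟨a, b, hab, h⟩ := exists_rowOf_eq β hβ
  have hrow : ∑ ρ ∈ β.rowStabilizer, ((Perm.sign ρ : ℤ) : k) = 0 := by
    refine sum_sign_eq_zero_of_swap hab fun π hπ => ?_
    simp only [Nat.Partition.rowStabilizer, Finset.mem_filter, Finset.mem_univ, true_and] at hπ ⊢
    intro i
    rw [Perm.mul_apply, ← hπ i]
    exact apply_swap_eq (f := fun x : Fin q => rowOf β.rowLengths x) h (π i)
  have := sum_mul_irrChar_eq_zero (k := k) β (permSignHom k _) (by
    rw [lift_youngSymmetrizer]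
    simp only [permSignHom_apply, hrow, zero_mul])
  simpa [permSignHom_apply] using this

end SpechtModule
-- Hessenberg weights and class functions
section Hessenberg

variable {k : Type*} [Field k]

/-- The matrix with all-ones columns before column `m`; from column `m` on, it is the lower
Hessenberg matrix with ones on and below the diagonal, and `1, 2, 3, …` just above it. -/
def partialHessenberg (k : Type*) [Field k] (q m : ℕ) : Matrix (Fin q) (Fin q) k :=
  Matrix.of fun i j =>
    if (j : ℕ) < m ∨ (j : ℕ) ≤ i then 1 else if (j : ℕ) = i + 1 then ((i : ℕ) : k) + 1 else 0

/-- Rows above $m-1$ each lose 1, and row $m-1$ makes up the deficit: replacing the column preserves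
its sum. -/
theorem sum_range_hessenberg_column (m n : ℕ) :
    ∑ i ∈ Finset.range n, ((if m ≤ i then 1 else if m = i + 1 then (i : k) + 1 else 0) - 1) =
      if m ≤ n then 0 else -(n : k) := by
  induction n with
  | zero => simp
  | succ n ih =>
    rw [Finset.sum_range_succ, ih]
    split_ifs <;> first | omega | (push_cast; ring)

theorem sum_partialHessenberg_column {q m : ℕ} (hm : m < q) :
    ∑ i : Fin q, (partialHessenberg k q m i ⟨m, hm⟩ - 1) = 0 := by
  have := sum_range_hessenberg_column (k := k) m q
  rw [if_pos hm.le, Finset.sum_range] at this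
  simpa only [partialHessenberg, Matrix.of_apply, lt_irrefl, false_or] using this

/-- Columns before $m$ are constant, and columns after $m$ vanish in rows $a,b$. Hence conjugation
by the swap preserves the weight outside column $m$. -/
theorem partialHessenberg_swap {q m : ℕ} {a b : Fin q} (ha : (a : ℕ) < m) (hb : (b : ℕ) < m)
    {j : Fin q} (hj : (j : ℕ) ≠ m) (i : Fin q) :
    partialHessenberg k q (m + 1) (swap a b i) (swap a b j) =
      partialHessenberg k q (m + 1) i j := by
  rcases lt_or_gt_of_ne hj with h | h
  · have : (swap a b j : ℕ) < m := by
      rw [swap_apply_def]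
      split_ifs <;> assumption
    simp only [partialHessenberg, Matrix.of_apply]
    rw [if_pos (by omega), if_pos (by omega)]
  · rw [swap_apply_of_ne_of_ne (x := j) (by rintro rfl; omega) (by rintro rfl; omega)]
    refine apply_swap_eq (f := fun i => partialHessenberg k q (m + 1) i j) ?_ i
    simp only [partialHessenberg, Matrix.of_apply]
    rw [if_neg (by omega), if_neg (by omega), if_neg (by omega), if_neg (by omega)]

/-- Only column $m$ changes. Group permutations by $i=\pi(m)$, with `G i` the sum that omits column
$m$. Conjugation makes `G` constant on $i<m$, the only rows where the two columns differ, and the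
column sums agree. -/
theorem sum_partialHessenberg_succ {q m : ℕ} (hm : m < q) (f : Perm (Fin q) → k)
    (hf : ∀ g h, f (h * g * h⁻¹) = f g) :
    ∑ π, f π * ∏ j, partialHessenberg k q (m + 1) (π j) j =
      ∑ π, f π * ∏ j, partialHessenberg k q m (π j) j := by
  set c : Fin q := ⟨m, hm⟩ with hc
  set P : Perm (Fin q) → k := fun π =>
    ∏ j ∈ Finset.univ.erase c, partialHessenberg k q (m + 1) (π j) j with hP
  set G : Fin q → k := fun i => ∑ π : Perm (Fin q) with π c = i, f π * P π with hG
  have hone : ∀ i, partialHessenberg k q (m + 1) i c = 1 := by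
    intro i
    simp [partialHessenberg, hc]
  have h1 : ∀ π : Perm (Fin q), ∏ j, partialHessenberg k q (m + 1) (π j) j = P π := by
    intro π
    rw [← Finset.mul_prod_erase _ _ (Finset.mem_univ c), hone, one_mul]
  have h2 : ∀ π : Perm (Fin q), ∏ j, partialHessenberg k q m (π j) j =
      partialHessenberg k q m (π c) c * P π := by
    intro π
    rw [← Finset.mul_prod_erase _ _ (Finset.mem_univ c)]
    congr 1
    refine Finset.prod_congr rfl fun j hj => ?_
    have hjm : (j : ℕ) ≠ m := fun h => (Finset.mem_erase.1 hj).1 (Fin.ext h)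
    have : ((j : ℕ) < m + 1) ↔ (j : ℕ) < m := by omega
    simp only [partialHessenberg, Matrix.of_apply, this]
  have hGc : ∀ a b : Fin q, (a : ℕ) < m → (b : ℕ) < m → G a = G b := by
    intro a b ha hb
    have hcc : swap a b c = c :=
      swap_apply_of_ne_of_ne (by rintro rfl; simp [hc] at ha) (by rintro rfl; simp [hc] at hb)
    simp only [hG, Finset.sum_filter]
    refine Fintype.sum_equiv (MulAut.conj (swap a b)).toEquiv _ _ fun π => ?_
    have hPc : P (swap a b * π * (swap a b)⁻¹) = P π := by
      simp only [hP]
      refine (Finset.prod_equiv (swap a b) ?_ ?_).symm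
      · intro j
        simp only [Finset.mem_erase, Finset.mem_univ, and_true, ne_eq]
        nth_rewrite 2 [← hcc]
        rw [(swap a b).injective.eq_iff]
      · intro j hj
        have hjm : (j : ℕ) ≠ m := fun h => (Finset.mem_erase.1 hj).1 (Fin.ext h)
        rw [← partialHessenberg_swap ha hb hjm]
        simp
    have hiff : (swap a b * π * (swap a b)⁻¹) c = b ↔ π c = a := by
      simp only [Perm.mul_apply, swap_inv, hcc]
      rw [swap_apply_eq_iff, swap_apply_right]
    simp only [MulEquiv.toEquiv_eq_coe, EquivLike.coe_coe, MulAut.conj_apply, hiff, hf, hPc]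
  have h3 : ∀ w : Fin q → k, ∑ π, f π * (w (π c) * P π) = ∑ i, w i * G i := by
    intro w
    rw [← Finset.sum_fiberwise Finset.univ (fun π : Perm (Fin q) => π c)]
    refine Finset.sum_congr rfl fun i _ => ?_
    simp only [hG, Finset.mul_sum]
    refine Finset.sum_congr rfl fun π hπ => ?_
    rw [(Finset.mem_filter.1 hπ).2]
    ring
  have h4 := h3 fun _ => 1
  simp only [one_mul] at h4
  simp only [h1, h2, h4, h3 fun i => partialHessenberg k q m i c]
  rw [eq_comm, ← sub_eq_zero, ← Finset.sum_sub_distrib]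
  -- The index $m-1$ represents all rows below $m$. For $m=0$ it truncates to 0, harmlessly: the
  -- factor before `G` is then zero.
  have h5 : ∀ i, partialHessenberg k q m i c * G i - G i =
      (partialHessenberg k q m i c - 1) * G ⟨m - 1, by omega⟩ := by
    intro i
    rcases lt_or_ge (i : ℕ) m with h | h
    · rw [hGc i ⟨m - 1, by omega⟩ h (by simp; omega)]
      ring
    · have : partialHessenberg k q m i c = 1 := if_pos (Or.inr h)
      rw [this]
      ring
  rw [Finset.sum_congr rfl fun i _ => h5 i, ← Finset.sum_mul, sum_partialHessenberg_column hm,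
    zero_mul]

/-- The generating-function form of Feller's coupling: a class function has the same sum over all
permutations as over the lower Hessenberg permutations with the weights given by the matrix. -/
theorem sum_partialHessenberg_zero {q : ℕ} (f : Perm (Fin q) → k)
    (hf : ∀ g h, f (h * g * h⁻¹) = f g) :
    ∑ π, f π * ∏ j, partialHessenberg k q 0 (π j) j = ∑ π, f π := by
  have h : ∀ m ≤ q, ∑ π, f π * ∏ j, partialHessenberg k q 0 (π j) j =
      ∑ π, f π * ∏ j, partialHessenberg k q m (π j) j := by
    intro m
    induction m with
    | zero => simp
    | succ m ih => intro hm; rw [ih (by omega), sum_partialHessenberg_succ hm f hf]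
  rw [h q le_rfl]
  simp [partialHessenberg]

theorem eq_one_of_forall_le {q : ℕ} {π : Perm (Fin q)} (h : ∀ i, π i ≤ i) : π = 1 := by
  have key : ∀ n, ∀ i : Fin q, (i : ℕ) = n → π i = i := by
    intro n
    induction n using Nat.strong_induction_on with
    | _ n ih =>
      intro i hi
      by_contra hne
      have hlt : π i < i := lt_of_le_of_ne (h i) hne
      exact hne (π.injective (ih (π i) (by rw [← hi]; exact hlt) _ rfl))
  ext i
  simp [key i i rfl]

/-- The sign of a lower Hessenberg permutation is given by the number of its excedances. -/
theorem sign_eq_prod_excedance {q : ℕ} (π : Perm (Fin q)) (h : ∀ i, (π i : ℕ) ≤ i + 1) :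
    (Perm.sign π : ℤ) = ∏ i, if i < π i then -1 else 1 := by
  induction hn : (Finset.univ.filter fun i => i < π i).card using Nat.strong_induction_on
    generalizing π with
  | _ n ih =>
    rcases (Finset.univ.filter fun i => i < π i).eq_empty_or_nonempty with h0 | h0
    · have hle : ∀ i, π i ≤ i := fun i => by
        have := Finset.filter_eq_empty_iff.1 h0 (Finset.mem_univ i)
        exact not_lt.1 this
      rw [eq_one_of_forall_le hle]
      simp
    -- For the largest excedance $a$, the value $b=a+1$ is not an excedance, so $\pi(b)\le a$.
    -- Composing with the swap of $a,b$ fixes $b$ and removes exactly the excedance $a$.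
    · obtain ⟨a, ha, hmax⟩ := Finset.exists_max_image _ (fun i => i) h0
      simp only [Finset.mem_filter, Finset.mem_univ, true_and] at ha hmax
      have hab : (π a : ℕ) = a + 1 := le_antisymm (h a) ha
      set b := π a with hb
      have hne : a ≠ b := ha.ne
      have hbb : π b ≤ b := by
        by_contra hlt
        have := hmax b (not_le.1 hlt)
        exact absurd ha (not_lt.2 this)
      have hba : π b ≤ a := by
        have h1 : π b ≠ b := fun h => hne (π.injective (h.trans hb)).symm
        have h2 : (π b : ℕ) ≠ b := fun h => h1 (Fin.ext h)
        have h3 : (π b : ℕ) ≤ b := hbb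
        exact Fin.le_def.2 (by omega)
      set σ := π * swap a b with hσ
      have hσa : σ a = π b := by simp [hσ]
      have hσb : σ b = b := by simp [hσ, ← hb]
      have hσo : ∀ i, i ≠ a → i ≠ b → σ i = π i := fun i h1 h2 => by
        simp [hσ, swap_apply_of_ne_of_ne h1 h2]
      have hiff : ∀ i, i ≠ a → (i < σ i ↔ i < π i) := by
        intro i hi
        by_cases hib : i = b
        · rw [hib, hσb]
          exact iff_of_false (lt_irrefl _) (not_lt.2 hbb)
        · rw [hσo i hi hib]
      have hσa' : ¬ a < σ a := by rw [hσa]; exact not_lt.2 hba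
      have hfil : (Finset.univ.filter fun i => i < σ i) =
          (Finset.univ.filter fun i => i < π i).erase a := by
        ext i
        by_cases hi : i = a
        · subst hi; simp [hσa']
        · simp [hi, hiff i hi]
      have hamem : a ∈ Finset.univ.filter fun i => i < π i := by simpa [← hb] using ha
      have hσh : ∀ i, (σ i : ℕ) ≤ i + 1 := by
        intro i
        by_cases hi : i = a
        · rw [hi, hσa]
          have : (π b : ℕ) ≤ a := hba
          omega
        · by_cases hib : i = b
          · rw [hib, hσb]; omega
          · rw [hσo i hi hib]; exact h i
      have hrec := ih _ (by rw [← hn, hfil]; exact Finset.card_erase_lt_of_mem hamem) σ hσh rfl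
      have hsig : (Perm.sign π : ℤ) = - (Perm.sign σ : ℤ) := by
        simp [hσ, Perm.sign_swap hne]
      rw [hsig, hrec, ← Finset.mul_prod_erase _ _ (Finset.mem_univ a),
        ← Finset.mul_prod_erase _ (fun i => if i < π i then (-1 : ℤ) else 1) (Finset.mem_univ a),
        if_neg hσa', if_pos (by rw [← hb]; exact ha), one_mul, neg_one_mul]
      congr 1
      refine Finset.prod_congr rfl fun i hi => ?_
      simp only [hiff i (Finset.mem_erase.1 hi).1]

/-- Conjugating $T_q$ by $\mathrm{diag}((-1)^i)$ changes no such product and leaves minus signs only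
above the diagonal, one per excedance. -/
theorem sign_mul_prod_partialHessenberg {q : ℕ} (π : Perm (Fin q)) :
    ((Perm.sign π : ℤ) : k) * ∏ i, partialHessenberg k q 0 i (π i) = ∏ i, matT k q i (π i) := by
  by_cases h : ∀ i, (π i : ℕ) ≤ i + 1
  · have hpar : ∏ i : Fin q, ((-1 : k) ^ (i : ℕ) * (-1) ^ (π i : ℕ)) = 1 := by
      rw [Finset.prod_mul_distrib, Equiv.prod_comp π fun i : Fin q => (-1 : k) ^ (i : ℕ),
        ← Finset.prod_mul_distrib]
      refine Finset.prod_eq_one fun i _ => ?_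
      rw [← mul_pow]
      simp
    rw [sign_eq_prod_excedance π h, Int.cast_prod, ← Finset.prod_mul_distrib,
      ← one_mul (∏ i, _), ← hpar, ← Finset.prod_mul_distrib]
    refine Finset.prod_congr rfl fun i _ => ?_
    simp only [partialHessenberg, matT, Matrix.of_apply, not_lt_zero, false_or, Fin.lt_def]
    rcases Nat.lt_or_ge i (π i) with hi | hi
    · have hi1 : (π i : ℕ) = i + 1 := le_antisymm (h i) hi
      have hsq : (-1 : k) ^ (i : ℕ) * (-1) ^ (i : ℕ) = 1 := by rw [← mul_pow]; simp
      simp only [hi1, pow_succ]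
      rw [if_pos (by omega), if_neg (by omega), if_pos trivial, if_neg (by omega)]
      push_cast
      linear_combination ((i : ℕ) + 1 : k) * hsq
    · rw [if_neg (by omega), if_pos hi, if_pos hi]
      obtain ⟨d, hd⟩ := Nat.exists_eq_add_of_le hi
      have hsq : (-1 : k) ^ (π i : ℕ) * (-1) ^ (π i : ℕ) = 1 := by rw [← mul_pow]; simp
      rw [hd, Nat.add_sub_cancel_left, pow_add]
      push_cast
      linear_combination (-1 : k) ^ d * hsq
  · push Not at h
    obtain ⟨i, hi⟩ := h
    rw [Finset.prod_eq_zero (Finset.mem_univ i), Finset.prod_eq_zero (Finset.mem_univ i), mul_zero]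
    · simp only [matT, Matrix.of_apply]
      rw [if_neg (by omega), if_neg (by omega)]
    · simp only [partialHessenberg, Matrix.of_apply]
      rw [if_neg (by omega), if_neg (by omega)]

end Hessenberg

/-! ### Evaluation on $H_q$ and $E_q$ -/

section Immanants

variable {k : Type*} [Field k]

theorem prod_matD_mul {q : ℕ} (A : Matrix (Fin q) (Fin q) k) (π : Perm (Fin q)) :
    ∏ i, (matD k q * A) i (π i) = ((q.factorial : ℕ) : k)⁻¹ * ∏ i, A i (π i) := by
  have hfac : ∏ i : Fin q, (((i : ℕ) : k) + 1) = (q.factorial : k) := by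
    rw [← Finset.prod_range_add_one_eq_factorial, Finset.prod_range]
    push_cast
    rfl
  simp only [matD, Matrix.diagonal_mul, Finset.prod_mul_distrib, one_div, Finset.prod_inv_distrib,
    hfac]

theorem sum_mul_prod_matH {q : ℕ} (f : Perm (Fin q) → k) :
    ∑ π, f π * ∏ i, matH k q i (π i) = ((q.factorial : ℕ) : k)⁻¹ * ∑ π, f π := by
  simp only [matH, prod_matD_mul, Matrix.of_apply, Finset.prod_const_one, mul_one,
    ← Finset.sum_mul, mul_comm]

theorem sum_mul_prod_matE {q : ℕ} (f : Perm (Fin q) → k) (hf : ∀ g h, f (h * g * h⁻¹) = f g) :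
    ∑ π, f π * ∏ i, matE k q i (π i) =
      ((q.factorial : ℕ) : k)⁻¹ * ∑ π, ((Perm.sign π : ℤ) : k) * f π := by
  -- Inverses appear because the Hessenberg sum uses entries $(\pi(j),j)$, whereas immanants use
  -- $(i,\pi(i))$.
  have hg := sum_partialHessenberg_zero (q := q)
    (fun π => ((Perm.sign π⁻¹ : ℤ) : k) * f π⁻¹) (by
      intro g h
      have : (h * g * h⁻¹)⁻¹ = h * g⁻¹ * h⁻¹ := by group
      rw [this, hf]
      congr 3
      simp only [map_mul, map_inv]
      rw [mul_right_comm, mul_inv_cancel, one_mul])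
  rw [← Equiv.sum_comp (Equiv.inv (Perm (Fin q))),
    ← Equiv.sum_comp (Equiv.inv (Perm (Fin q)))
      (fun π => ((Perm.sign π⁻¹ : ℤ) : k) * f π⁻¹)] at hg
  simp only [Equiv.inv_apply, inv_inv] at hg
  rw [← hg, Finset.mul_sum]
  refine Finset.sum_congr rfl fun π _ => ?_
  rw [matE, prod_matD_mul, ← sign_mul_prod_partialHessenberg,
    ← Equiv.prod_comp π fun j => partialHessenberg k q 0 (π⁻¹ j) j]
  simp only [Perm.coe_inv, symm_apply_apply]
  ring

end Immanants

theorem lemma5p1 (k : Type*) [Field k] [CharZero k] (q : ℕ) :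
    ((matH k q).permanent = 1 ∧
      ∀ β : Nat.Partition q, β ≠ Nat.Partition.indiscrete q → immanant β (matH k q) = 0) ∧
    ((matE k q).det = 1 ∧
      ∀ β : Nat.Partition q, β ≠ Nat.Partition.column q → immanant β (matE k q) = 0) := by
  have hq : (q.factorial : k) ≠ 0 := Nat.cast_ne_zero.2 q.factorial_ne_zero
  refine ⟨⟨?_, fun β hβ => ?_⟩, ?_, fun β hβ => ?_⟩
  · have := sum_mul_prod_matH (k := k) (q := q) fun _ => 1
    rw [← Matrix.permanent_transpose, Matrix.permanent]
    simp only [one_mul] at this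
    simp only [Matrix.transpose_apply, this]
    simp [Fintype.card_perm, hq]
  · rw [immanant, sum_mul_prod_matH, sum_irrChar_eq_zero β hβ, mul_zero]
  -- With $f=\mathrm{sgn}$ the signs square to 1, and the sum is $q!$.
  · have := sum_mul_prod_matE (k := k) (q := q) (fun π => ((Perm.sign π : ℤ) : k)) (by
      intro g h
      congr 2
      simp only [map_mul, map_inv]
      rw [mul_right_comm, mul_inv_cancel, one_mul])
    rw [← Matrix.det_transpose, Matrix.det_apply']
    simp only [Matrix.transpose_apply, this, ← Int.cast_mul, Int.units_coe_mul_self]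
    simp [Fintype.card_perm, hq]
  · rw [immanant, sum_mul_prod_matE _ (irrChar_conj β), sum_sign_mul_irrChar_eq_zero β hβ, mul_zero]
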